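/- Let $A$ be a real symmetric $N\times N$ matrix (the weighted adjacency matrix of a graph; the weights are arbitrary), and for $\sigma\in\{-1,1\}^N$ let $\mathcal C(\sigma)=\frac12\sum_{m,n}A_{m,n}\frac{1-\sigma_m\sigma_n}{2}$ be the cut defined by $\sigma$. Every real number $x$ is uniquely $x=s+Y+4k$ with $s\in\{-1,1\}$, $Y\in(-1,1]$, $k\in\mathbb Z$; write $s(x):=s$, and for $\xi\in\mathbb R^N$ and $r\in\mathbb R$ let $R_r(\xi)=(s(\xi_m-r))_m\in\{-1,1\}^N$ be the rounding of $\xi$ with rounding center $r$. The dynamics of the 2D Goemans--Williamson (GW$_2$) model is $$\dot\xi_m=\sum_n A_{m,n}\,\phi(\xi_m-\xi_n),\qquad m=1,\dots,N,$$ where $\phi$ has period $4$ and $\phi(x)=\frac12\operatorname{sgn}(x)$ for $x\in(-2,2]$, $\operatorname{sgn}(0)=0$. Since the right-hand side is discontinuous, solutions are understood in the sense of Filippov: $\xi:[0,\infty)\to\mathbb R^N$ is locally absolutely continuous and, for almost every $t$, $\dot\xi(t)\in F(\xi(t))$, where $F(x)$ is the intersection, over all $\delta>0$ and all Lebesgue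 null sets $Z$, of the closed convex hulls of the images of $B(x,\delta)\setminus Z$ under the right-hand side. Let $\sigma\in\{-1,1\}^N$, $X\in(-1,1]^N$, and let $\xi$ be any such solution with $\xi(0)=\sigma+X$. Then: 1. $\xi$ reaches a terminal state in finite time: there are $T\ge 0$ and $\xi^\infty\in\mathbb R^N$ with $\xi(t)=\xi^\infty$ for all $t\ge T$ and $0\in F(\xi^\infty)$. For every rounding center $r\in\mathbb R$, the terminal state rounds to a cut at least as large as the initial one: $\mathcal C(R_r(\xi^\infty))\ge\mathcal C(\sigma)$. 2. Spin flips strictly increase the cut: if $0\le s\le t$ and the binary components $R_0(\xi(s))$ and $R_0(\xi(t))$ are different, then $\mathcal C(R_0(\xi(s)))<\mathcal C(R_0(\xi(t)))$. -/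

import Mathlib

open MeasureTheory Set

noncomputable section

namespace GW2

/-- Binary states: all components are `1` or `-1`. -/
def IsBinary {N : ℕ} (σ : Fin N → ℝ) : Prop :=
  ∀ m, σ m = 1 ∨ σ m = -1

/-- The cut `C(σ) = (1/2) ∑_{m,n} A_{m,n} (1 - σ_m σ_n) / 2`: the total weight of the edges whose
endpoints carry opposite spins (each edge occurs twice in the double sum). -/
def cut {N : ℕ} (A : Matrix (Fin N) (Fin N) ℝ) (σ : Fin N → ℝ) : ℝ :=
  (1 / 2) * ∑ m, ∑ n, A m n * ((1 - σ m * σ n) / 2)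

theorem period_pos : (0 : ℝ) < 4 := by norm_num

/-- The function of period `4` that equals `sgn(x) / 2` on `(-2, 2]`, with `sgn 0 = 0`. -/
def phi (x : ℝ) : ℝ :=
  Real.sign (toIocMod period_pos (-2) x) / 2

/-- The vector field of the equations of motion. -/
def field {N : ℕ} (A : Matrix (Fin N) (Fin N) ℝ) (ξ : Fin N → ℝ) : Fin N → ℝ :=
  fun m => ∑ n, A m n * phi (ξ m - ξ n)

/-- Filippov's set-valued regularization of a (discontinuous) vector field `f`:
the intersection, over all radii `δ > 0` and all Lebesgue null sets `Z`, of the closed convex hulls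
of `f (B(x, δ) \ Z)`. (It is the same for all norms that define the balls.) -/
def filippov {N : ℕ} (f : (Fin N → ℝ) → (Fin N → ℝ)) (x : Fin N → ℝ) : Set (Fin N → ℝ) :=
  {v | ∀ δ : ℝ, 0 < δ → ∀ Z : Set (Fin N → ℝ), volume Z = 0 →
    v ∈ closure (convexHull ℝ (f '' (Metric.ball x δ \ Z)))}

/-- Trajectories: Filippov solutions, on the time half-line `[0, ∞)`, of the equations of motion,
that is, locally absolutely continuous curves whose velocity lies for almost every time in
Filippov's set. (The values of the curve at negative times play no role.) -/
structure IsTrajectory {N : ℕ} (A : Matrix (Fin N) (Fin N) ℝ) (ξ : ℝ → Fin N → ℝ) : Prop where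
  absCont : ∀ T : ℝ, 0 < T → AbsolutelyContinuousOnInterval ξ 0 T
  velocity : ∀ᵐ t ∂(volume.restrict (Ioi (0 : ℝ))),
    ∃ v ∈ filippov (field A) (ξ t), HasDerivAt ξ v t

/-- Equilibria (critical points) of the dynamics. -/
def IsEquilibrium {N : ℕ} (A : Matrix (Fin N) (Fin N) ℝ) (z : Fin N → ℝ) : Prop :=
  (0 : Fin N → ℝ) ∈ filippov (field A) z

/-- `z` is the terminal state of the curve `ξ`: it is reached in finite time and never left. -/
def IsTerminalState {N : ℕ} (ξ : ℝ → Fin N → ℝ) (z : Fin N → ℝ) : Prop :=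
  ∃ T : ℝ, 0 ≤ T ∧ ∀ t, T ≤ t → ξ t = z

/-- The binary component of a real number `x`: the `s ∈ {-1, 1}` in the unique representation
`x = s + X + 4 k` with `X ∈ (-1, 1]` and `k ∈ ℤ`. -/
def spin (x : ℝ) : ℝ :=
  if toIocMod period_pos 0 x ≤ 2 then 1 else -1

/-- The value of `spin` is the one in the representation that defines it. -/
theorem spin_eq_iff (x s : ℝ) (hs : s = 1 ∨ s = -1) :
    spin x = s ↔ ∃ X ∈ Ioc (-1 : ℝ) 1, ∃ k : ℤ, x = s + X + 4 * k := by
  have key : ∀ s : ℝ, (s = 1 ∨ s = -1) →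
      (∃ X ∈ Ioc (-1 : ℝ) 1, ∃ k : ℤ, x = s + X + 4 * k) → spin x = s := by
    rintro s hs ⟨X, ⟨h1, h2⟩, k, hk⟩
    rcases hs with rfl | rfl
    · have h : toIocMod period_pos 0 x = 1 + X :=
        (toIocMod_eq_iff period_pos).2
          ⟨⟨by linarith, by linarith⟩, k, by rw [hk, zsmul_eq_mul]; ring⟩
      rw [spin, h, if_pos (by linarith)]
    · have h : toIocMod period_pos 0 x = 3 + X :=
        (toIocMod_eq_iff period_pos).2
          ⟨⟨by linarith, by linarith⟩, k - 1, by rw [hk, zsmul_eq_mul]; push_cast; ring⟩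
      rw [spin, h, if_neg (by linarith)]
  refine ⟨?_, key s hs⟩
  rintro rfl
  have hmem := toIocMod_mem_Ioc period_pos 0 x
  have heq := toIocMod_add_toIocDiv_zsmul period_pos 0 x
  rw [zsmul_eq_mul] at heq
  by_cases h : toIocMod period_pos 0 x ≤ 2
  · rw [spin, if_pos h]
    exact ⟨toIocMod period_pos 0 x - 1, ⟨by linarith [hmem.1], by linarith⟩,
      toIocDiv period_pos 0 x, by linarith⟩
  · rw [spin, if_neg h]
    refine ⟨toIocMod period_pos 0 x - 3, ⟨by linarith, by linarith [hmem.2]⟩,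
      toIocDiv period_pos 0 x + 1, by push_cast; linarith⟩

/-- Rounding of the state `ξ` with respect to the rounding center `r`. -/
def rounding {N : ℕ} (r : ℝ) (ξ : Fin N → ℝ) : Fin N → ℝ :=
  fun m => spin (ξ m - r)

end GW2

end

noncomputable section

namespace GW2

open Filter Topology

/-! The piecewise linear `energy` interpolates the cut, and symmetry of `A` makes the dynamics its
gradient ascent. A curve can pass differentiably through a corner of `tent` with differentiable
image only at speed zero, so for almost every time components that agree modulo 2 move together. The
Filippov inclusion determines the inner product of the velocity `v` with every such locked vector.
Hence `v` is the projection of `drift` to the locked vectors (`IsTrajectory.ae_velocity`), and the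
energy grows at rate `v ⬝ᵥ v`.

The vector of residues modulo 2 around any center `r` is locked, so the energy equals the cut
rounded at `r` plus the product of `v` with the residues (`IsVelocity.energy_eq`). Two conclusions
follow.

Termination: if `v = 0`, the energy equals the rounded cut for every center. There are finitely many
cuts and finitely many velocities, so away from cut values the energy grows at a rate bounded below.
Being bounded, it attains its supremum in finite time, and then the motion stops.

Monotonicity: near a time `t₀`, comparing the centers 0 and a small `η` shows that the cut at time
`t` minus the cut at `t₀` is twice the derivative of `excess`, the total distance travelled upwards
beyond rounding boundaries. This excess vanishes at `t₀`, so positive excess forces a difference of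
cuts of the right sign, provided the cut is already monotone where the excess is positive. There
fewer components are even, which permits induction (`IsTrajectory.cutLE_local`). -/

/-! ### Scalar functions: residue, spin, tent and its slope -/

/-- The representative in `(0, 2]` of a real number modulo `2`. -/
def residue (x : ℝ) : ℝ := toIocMod (two_pos : (0 : ℝ) < 2) 0 x

/-- The function of period `4` that equals `|x| / 2` on `[-2, 2]`. -/
def tent (x : ℝ) : ℝ := ‖(x : AddCircle (4 : ℝ))‖ / 2

open Classical in
/-- The odd version of `phi`, which vanishes on `2ℤ`. -/
def oddPhi (x : ℝ) : ℝ := if ∃ k : ℤ, x = 2 * k then 0 else phi x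

theorem exists_int_add (x : ℝ) : ∃ k : ℤ, ∃ y ∈ Ioc (0 : ℝ) 2, x = 2 * k + y := by
  refine ⟨toIocDiv (two_pos : (0 : ℝ) < 2) 0 x, residue x, ?_, ?_⟩
  · simpa [residue] using toIocMod_mem_Ioc (two_pos : (0 : ℝ) < 2) 0 x
  · have := toIocMod_add_toIocDiv_mul (two_pos : (0 : ℝ) < 2) 0 x
    rw [residue]; linarith

theorem residue_int_add (k : ℤ) {y : ℝ} (hy : y ∈ Ioc (0 : ℝ) 2) : residue (2 * k + y) = y := by
  rw [residue, toIocMod_eq_iff]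
  exact ⟨by simpa using hy, k, by simp; ring⟩

theorem residue_eq_of_sub {x y : ℝ} {k : ℤ} (h : x - y = 2 * k) : residue x = residue y := by
  obtain ⟨l, z, hz, rfl⟩ := exists_int_add y
  have : x = 2 * ((k + l : ℤ) : ℝ) + z := by push_cast; linarith
  rw [this, residue_int_add _ hz, residue_int_add _ hz]

theorem spin_int_add (k : ℤ) {y : ℝ} (hy : y ∈ Ioc (0 : ℝ) 2) :
    spin (2 * k + y) = if Even k then 1 else -1 := by
  split_ifs with h
  · obtain ⟨j, rfl⟩ := h
    exact (spin_eq_iff _ _ (Or.inl rfl)).2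
      ⟨y - 1, ⟨by linarith [hy.1], by linarith [hy.2]⟩, j, by push_cast; ring⟩
  · obtain ⟨j, rfl⟩ := Int.not_even_iff_odd.1 h
    exact (spin_eq_iff _ _ (Or.inr rfl)).2
      ⟨y - 1, ⟨by linarith [hy.1], by linarith [hy.2]⟩, j + 1, by push_cast; ring⟩

theorem spin_eq_one_or (x : ℝ) : spin x = 1 ∨ spin x = -1 := by
  rw [spin]; split_ifs <;> simp

theorem tent_of_abs_sub_le {x : ℝ} {k : ℤ} (h : |x - 4 * k| ≤ 2) : tent x = |x - 4 * k| / 2 := by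
  have h1 : ((x - 4 * k : ℝ) : AddCircle (4 : ℝ)) = x := by
    rw [AddCircle.coe_sub, sub_eq_self, AddCircle.coe_eq_zero_iff]
    exact ⟨k, by simp; ring⟩
  rw [tent, ← h1, (AddCircle.norm_coe_eq_abs_iff 4 four_ne_zero).2]
  rw [abs_of_pos (four_pos : (0 : ℝ) < 4)]; linarith

theorem tent_of_abs_sub_le' {x : ℝ} {k : ℤ} (h : |x - (4 * k + 2)| ≤ 2) :
    tent x = 1 - |x - (4 * k + 2)| / 2 := by
  obtain ⟨h1, h2⟩ := abs_le.1 h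
  rcases le_total x (4 * k + 2) with h3 | h3
  · rw [tent_of_abs_sub_le (k := k) (abs_le.2 ⟨by linarith, by linarith⟩),
      abs_of_nonneg (by linarith), abs_of_nonpos (by linarith)]
    ring
  · rw [tent_of_abs_sub_le (k := k + 1) (abs_le.2 ⟨by push_cast; linarith, by push_cast; linarith⟩),
      abs_of_nonneg (a := x - (4 * k + 2)) (by linarith), abs_of_nonpos (by push_cast; linarith)]
    push_cast; ring

theorem abs_tent_sub_le (x y : ℝ) : |tent x - tent y| ≤ |x - y| := by
  have h1 : |‖(x : AddCircle (4 : ℝ))‖ - ‖(y : AddCircle (4 : ℝ))‖| ≤ |x - y| := by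
    refine (abs_norm_sub_norm_le _ _).trans ?_
    rw [← AddCircle.coe_sub]
    exact QuotientAddGroup.norm_mk_le_norm
  have h2 : tent x - tent y = (‖(x : AddCircle (4 : ℝ))‖ - ‖(y : AddCircle (4 : ℝ))‖) / 2 := by
    rw [tent, tent]; ring
  rw [h2, abs_div, abs_two]
  linarith [abs_nonneg (‖(x : AddCircle (4 : ℝ))‖ - ‖(y : AddCircle (4 : ℝ))‖)]

theorem tent_nonneg (x : ℝ) : 0 ≤ tent x := by
  rw [tent]; positivity

theorem tent_le_one (x : ℝ) : tent x ≤ 1 := by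
  have := AddCircle.norm_le_half_period (4 : ℝ) (x := (x : AddCircle (4 : ℝ))) four_ne_zero
  rw [abs_of_pos (four_pos : (0 : ℝ) < 4)] at this
  rw [tent]; linarith

theorem oddPhi_even (k : ℤ) : oddPhi (2 * k) = 0 := by
  rw [oddPhi, if_pos ⟨k, rfl⟩]

theorem phi_of_pos {x : ℝ} {k : ℤ} (h1 : 0 < x - 4 * k) (h2 : x - 4 * k < 2) : phi x = 1 / 2 := by
  have : toIocMod period_pos (-2) x = x - 4 * k :=
    (toIocMod_eq_iff _).2 ⟨⟨by linarith, by linarith⟩, k, by simp; ring⟩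
  rw [phi, this, Real.sign_of_pos h1]

theorem phi_of_neg {x : ℝ} {k : ℤ} (h1 : -2 < x - 4 * k) (h2 : x - 4 * k < 0) :
    phi x = -1 / 2 := by
  have : toIocMod period_pos (-2) x = x - 4 * k :=
    (toIocMod_eq_iff _).2 ⟨⟨by linarith, by linarith⟩, k, by simp; ring⟩
  rw [phi, this, Real.sign_of_neg h2]

theorem ne_even_of_lt {x : ℝ} {k : ℤ} (h1 : 2 * k < x) (h2 : x < 2 * k + 2) (j : ℤ) :
    x ≠ 2 * j := by
  rintro rfl
  have h3 : k < j := by exact_mod_cast (by linarith : (k : ℝ) < j)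
  have h4 : j < k + 1 := by exact_mod_cast (by linarith : (j : ℝ) < k + 1)
  omega

theorem oddPhi_of_pos {x : ℝ} {k : ℤ} (h1 : 0 < x - 4 * k) (h2 : x - 4 * k < 2) :
    oddPhi x = 1 / 2 := by
  rw [oddPhi, if_neg, phi_of_pos h1 h2]
  rintro ⟨j, hj⟩
  exact ne_even_of_lt (k := 2 * k) (by push_cast; linarith) (by push_cast; linarith) j hj

theorem oddPhi_of_neg {x : ℝ} {k : ℤ} (h1 : -2 < x - 4 * k) (h2 : x - 4 * k < 0) :
    oddPhi x = -1 / 2 := by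
  rw [oddPhi, if_neg, phi_of_neg h1 h2]
  rintro ⟨j, hj⟩
  exact ne_even_of_lt (k := 2 * k - 1) (by push_cast; linarith) (by push_cast; linarith) j hj

/-- A real number is even, or it lies strictly between multiples of `4` and the midpoints. -/
theorem even_or_pos_or_neg (x : ℝ) : (∃ k : ℤ, x = 2 * k) ∨
    (∃ k : ℤ, 0 < x - 4 * k ∧ x - 4 * k < 2) ∨ ∃ k : ℤ, -2 < x - 4 * k ∧ x - 4 * k < 0 := by
  obtain ⟨k, y, ⟨h1, h2⟩, rfl⟩ := exists_int_add x
  rcases h2.eq_or_lt with rfl | h2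
  · exact Or.inl ⟨k + 1, by push_cast; ring⟩
  · rcases Int.even_or_odd' k with ⟨j, rfl | rfl⟩
    · exact Or.inr (Or.inl ⟨j, by push_cast; linarith, by push_cast; linarith⟩)
    · exact Or.inr (Or.inr ⟨j + 1, by push_cast; linarith, by push_cast; linarith⟩)

theorem oddPhi_neg (x : ℝ) : oddPhi (-x) = -oddPhi x := by
  rcases even_or_pos_or_neg x with ⟨k, rfl⟩ | ⟨k, h1, h2⟩ | ⟨k, h1, h2⟩
  · have := oddPhi_even (-k)
    push_cast at this
    rw [← mul_neg, this, oddPhi_even, neg_zero]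
  · rw [oddPhi_of_pos h1 h2, oddPhi_of_neg (k := -k)] <;> (try push_cast) <;> linarith
  · rw [oddPhi_of_neg h1 h2, oddPhi_of_pos (k := -k)] <;> (try push_cast) <;> linarith

theorem oddPhi_mem (x : ℝ) : oddPhi x ∈ ({0, 1 / 2, -1 / 2} : Set ℝ) := by
  rcases even_or_pos_or_neg x with ⟨k, rfl⟩ | ⟨k, h1, h2⟩ | ⟨k, h1, h2⟩
  · simp [oddPhi_even]
  · simp [oddPhi_of_pos h1 h2]
  · simp [oddPhi_of_neg h1 h2]

theorem oddPhi_eq_zero_iff {x : ℝ} : oddPhi x = 0 ↔ ∃ k : ℤ, x = 2 * k := by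
  constructor
  · intro h
    rcases even_or_pos_or_neg x with h' | ⟨k, h1, h2⟩ | ⟨k, h1, h2⟩
    · exact h'
    · rw [oddPhi_of_pos h1 h2] at h; norm_num at h
    · rw [oddPhi_of_neg h1 h2] at h; norm_num at h
  · rintro ⟨k, rfl⟩
    exact oddPhi_even k

theorem oddPhi_eq_phi {x : ℝ} (h : ¬ ∃ k : ℤ, x = 2 * k) : oddPhi x = phi x := by
  rw [oddPhi, if_neg h]

theorem oddPhi_eventually_eq {x : ℝ} (h : ¬ ∃ k : ℤ, x = 2 * k) :
    ∀ᶠ y in 𝓝 x, oddPhi y = oddPhi x := by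
  rcases even_or_pos_or_neg x with h' | ⟨k, h1, h2⟩ | ⟨k, h1, h2⟩
  · exact absurd h' h
  · filter_upwards [Ioo_mem_nhds (by linarith : 4 * (k : ℝ) < x) (by linarith : x < 4 * k + 2)]
      with y hy
    rw [oddPhi_of_pos h1 h2, oddPhi_of_pos (k := k)] <;> linarith [hy.1, hy.2]
  · filter_upwards [Ioo_mem_nhds (by linarith : 4 * (k : ℝ) - 2 < x) (by linarith : x < 4 * k)]
      with y hy
    rw [oddPhi_of_neg h1 h2, oddPhi_of_neg (k := k)] <;> linarith [hy.1, hy.2]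

/-- Write `a = 2k + α` and `b = 2l + β` with residues `α`, `β`. The parity of `k - l` decides both
whether the spins agree and whether `a - b` lies within 2 of a minimum or of a maximum of `tent`; on
either side of that point the slope is `oddPhi (a - b)`. -/
theorem tent_sub_eq (a b : ℝ) : tent (a - b) =
    (1 - spin a * spin b) / 2 + oddPhi (a - b) * (residue a - residue b) := by
  obtain ⟨k, α, hα, rfl⟩ := exists_int_add a
  obtain ⟨l, β, hβ, rfl⟩ := exists_int_add b
  rw [residue_int_add k hα, residue_int_add l hβ, spin_int_add k hα, spin_int_add l hβ]
  obtain ⟨hα1, hα2⟩ := hα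
  obtain ⟨hβ1, hβ2⟩ := hβ
  rcases Int.even_or_odd' (k - l) with ⟨j, hj⟩
  rcases hj with hj | hj
  · have hs : ((if Even k then 1 else -1 : ℝ) * if Even l then 1 else -1) = 1 := by
      have : Even k ↔ Even l := by
        have : Even (k - l) := ⟨j, by omega⟩
        rwa [Int.even_sub] at this
      by_cases h : Even l <;> simp [this, h]
    have hk : (k : ℝ) = 2 * j + l := by exact_mod_cast (by omega : k = 2 * j + l)
    have hd : 2 * (k : ℝ) + α - (2 * l + β) - 4 * j = α - β := by rw [hk]; ring
    rw [hs, tent_of_abs_sub_le (k := j) (by rw [hd]; exact abs_le.2 ⟨by linarith, by linarith⟩), hd]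
    rcases lt_trichotomy α β with h | h | h
    · rw [abs_of_neg (by linarith), oddPhi_of_neg (k := j) (by linarith) (by linarith)]; ring
    · simp [h]
    · rw [abs_of_pos (by linarith), oddPhi_of_pos (k := j) (by linarith) (by linarith)]; ring
  · have hs : ((if Even k then 1 else -1 : ℝ) * if Even l then 1 else -1) = -1 := by
      have : ¬ (Even k ↔ Even l) := by
        have : Odd (k - l) := ⟨j, by omega⟩
        rwa [← Int.not_even_iff_odd, Int.even_sub] at this
      by_cases h : Even l <;> by_cases h' : Even k <;> simp_all
    have hk : (k : ℝ) = 2 * j + 1 + l := by exact_mod_cast (by omega : k = 2 * j + 1 + l)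
    have hd : 2 * (k : ℝ) + α - (2 * l + β) - (4 * j + 2) = α - β := by rw [hk]; ring
    rw [hs, tent_of_abs_sub_le' (k := j) (by rw [hd]; exact abs_le.2 ⟨by linarith, by linarith⟩),
      hd]
    rcases lt_trichotomy α β with h | h | h
    · rw [abs_of_neg (by linarith), oddPhi_of_pos (k := j) (by linarith) (by linarith)]; ring
    · simp [h]
    · rw [abs_of_pos (by linarith),
        oddPhi_of_neg (k := j + 1) (by push_cast; linarith) (by push_cast; linarith)]
      ring

/-! ### Chain rule at the corners of the tent -/

theorem hasDerivAt_zero_of_abs {f : ℝ → ℝ} {f' t : ℝ} (hf : HasDerivAt f f' t) (h0 : f t = 0)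
    (hd : DifferentiableAt ℝ (fun s => |f s|) t) : f' = 0 := by
  have hmin : IsLocalMin (fun s => |f s|) t :=
    Eventually.of_forall fun s => by simp [h0]
  have h1 := hmin.deriv_eq_zero ▸ hd.hasDerivAt
  have h2 : HasDerivAt f 0 t := by
    rw [hasDerivAt_iff_isLittleO] at h1 ⊢
    simp only [h0, abs_zero, sub_zero, smul_zero] at h1 ⊢
    exact h1.of_norm_left
  exact hf.unique h2

theorem hasDerivAt_tent {x : ℝ} (h : ¬ ∃ k : ℤ, x = 2 * k) : HasDerivAt tent (oddPhi x) x := by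
  rcases even_or_pos_or_neg x with h' | ⟨k, h1, h2⟩ | ⟨k, h1, h2⟩
  · exact absurd h' h
  · rw [oddPhi_of_pos h1 h2]
    have : HasDerivAt (fun y : ℝ => (y - 4 * k) / 2) (1 / 2) x :=
      ((hasDerivAt_id x).sub_const _).div_const 2
    refine this.congr_of_eventuallyEq ?_
    filter_upwards [Ioo_mem_nhds (by linarith : 4 * (k : ℝ) < x) (by linarith : x < 4 * k + 2)]
      with y hy
    have h3 := abs_of_pos (by linarith [hy.1] : 0 < y - 4 * k)
    rw [tent_of_abs_sub_le (k := k) (by rw [h3]; linarith [hy.2]), h3]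
  · rw [oddPhi_of_neg h1 h2]
    have : HasDerivAt (fun y : ℝ => -(y - 4 * k) / 2) (-1 / 2) x :=
      ((hasDerivAt_id x).sub_const _).neg.div_const 2
    refine this.congr_of_eventuallyEq ?_
    filter_upwards [Ioo_mem_nhds (by linarith : 4 * (k : ℝ) - 2 < x) (by linarith : x < 4 * k)]
      with y hy
    have h3 := abs_of_neg (by linarith [hy.2] : y - 4 * k < 0)
    rw [tent_of_abs_sub_le (k := k) (by rw [h3]; linarith [hy.1]), h3]

theorem deriv_eq_zero_of_tent_comp {u : ℝ → ℝ} {w t : ℝ} (hu : HasDerivAt u w t)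
    (hd : DifferentiableAt ℝ (fun s => tent (u s)) t) (h : ∃ k : ℤ, u t = 2 * k) : w = 0 := by
  obtain ⟨k, hk⟩ := h
  have hnhds : ∀ᶠ s in 𝓝 t, |u s - 2 * k| ≤ 2 := by
    have hc : ContinuousAt (fun s => |u s - 2 * k|) t := (hu.continuousAt.sub_const _).abs
    have : |u t - 2 * k| < 2 := by rw [hk]; simp
    exact (hc.eventually_lt continuousAt_const this).mono fun s hs => hs.le
  have hu' : HasDerivAt (fun s => u s - 2 * k) w t := hu.sub_const _
  refine hasDerivAt_zero_of_abs hu' (by rw [hk]; ring) ?_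
  rcases Int.even_or_odd' k with ⟨j, rfl | rfl⟩
  · refine (hd.const_mul 2).congr_of_eventuallyEq ?_
    filter_upwards [hnhds] with s hs
    push_cast at hs ⊢
    have h4 : (2 : ℝ) * (2 * j) = 4 * j := by ring
    rw [h4] at hs ⊢
    rw [tent_of_abs_sub_le hs]; ring
  · refine ((hd.const_sub 1).const_mul 2).congr_of_eventuallyEq ?_
    filter_upwards [hnhds] with s hs
    push_cast at hs ⊢
    have h4 : (2 : ℝ) * (2 * j + 1) = 4 * j + 2 := by ring
    rw [h4] at hs ⊢
    rw [tent_of_abs_sub_le' hs]; ring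

/-- At a corner the inner derivative vanishes, and the Lipschitz bound on `tent` carries this over
to the composition. -/
theorem hasDerivAt_tent_comp {u : ℝ → ℝ} {w t : ℝ} (hu : HasDerivAt u w t)
    (hd : DifferentiableAt ℝ (fun s => tent (u s)) t) :
    HasDerivAt (fun s => tent (u s)) (oddPhi (u t) * w) t := by
  by_cases h : ∃ k : ℤ, u t = 2 * k
  · have hw := deriv_eq_zero_of_tent_comp hu hd h
    subst hw
    rw [mul_zero]
    have h1 : HasDerivAt (fun s => tent (u s)) 0 t := by
      rw [hasDerivAt_iff_isLittleO] at hu ⊢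
      simp only [smul_zero, sub_zero] at hu ⊢
      refine Asymptotics.IsBigO.trans_isLittleO ?_ hu
      exact Asymptotics.IsBigO.of_bound 1 (Eventually.of_forall fun s => by
        simpa using abs_tent_sub_le (u s) (u t))
    exact h1
  · exact (hasDerivAt_tent h).comp t hu

/-! ### Shifting the rounding center -/

/-- How the spin and the residue react to a small shift of the rounding center, near `a`. -/
theorem eventually_shift (a : ℝ) : ∀ᶠ η in 𝓝[>] (0 : ℝ), ∀ x, |x - a| < η →
    spin (x - η) = spin a ∧
    (((∃ k : ℤ, a = 2 * k) ∧ a < x → residue (x - η) = residue x + (2 - η)) ∧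
      (¬ ((∃ k : ℤ, a = 2 * k) ∧ a < x) → residue (x - η) = residue x - η ∧ spin x = spin a)) ∧
    ((∃ k : ℤ, x = 2 * k) → (∃ k : ℤ, a = 2 * k) ∧ x = a) := by
  obtain ⟨k, α, ⟨h1, h2⟩, rfl⟩ := exists_int_add a
  -- `α = 2` is the boundary case: `a` is even and carries the spin of the interval below it, so any
  -- upward motion flips the spin.
  rcases h2.eq_or_lt with rfl | h2
  · filter_upwards [Ioo_mem_nhdsGT (by norm_num : (0 : ℝ) < 1 / 2)] with η hη x hx
    obtain ⟨hη1, hη2⟩ := hη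
    obtain ⟨hx1, hx2⟩ := abs_lt.1 hx
    have ha : ∃ j : ℤ, 2 * (k : ℝ) + 2 = 2 * j := ⟨k + 1, by push_cast; ring⟩
    have e1 : x - η = 2 * k + (x - η - 2 * k) := by ring
    have m1 : x - η - 2 * k ∈ Ioc (0 : ℝ) 2 := ⟨by linarith, by linarith⟩
    have m2 : (2 : ℝ) ∈ Ioc (0 : ℝ) 2 := ⟨two_pos, le_rfl⟩
    refine ⟨?_, ⟨fun h => ?_, fun h => ?_⟩, fun h => ⟨ha, ?_⟩⟩
    · rw [e1, spin_int_add k m1, spin_int_add k m2]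
    · have e2 : x = 2 * ((k + 1 : ℤ) : ℝ) + (x - 2 * k - 2) := by push_cast; ring
      rw [e1, residue_int_add k m1, e2,
        residue_int_add _ ⟨by linarith [h.2], by linarith⟩]
      push_cast; ring
    · have h3 : x ≤ 2 * k + 2 := by
        by_contra h4
        exact h ⟨ha, not_le.1 h4⟩
      have e2 : x = 2 * k + (x - 2 * k) := by ring
      have m3 : x - 2 * k ∈ Ioc (0 : ℝ) 2 := ⟨by linarith, by linarith⟩
      constructor
      · rw [e1, residue_int_add k m1, e2, residue_int_add k m3]; ring
      · rw [e2, spin_int_add k m3, spin_int_add k m2]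
    · obtain ⟨j, rfl⟩ := h
      rcases lt_trichotomy (2 * (j : ℝ)) (2 * k + 2) with h | h | h
      · exact absurd rfl (ne_even_of_lt (k := k) (by linarith) h j)
      · exact h
      · exact absurd rfl (ne_even_of_lt (k := k + 1) (by push_cast; linarith)
          (by push_cast; linarith) j)
  -- The bound `α / 2` keeps `x - η > a - 2η` above `2k`; the bound `2 - α` keeps `x` below `2k +
  -- 2`.
  · filter_upwards [Ioo_mem_nhdsGT (by linarith : (0 : ℝ) < α / 2),
      Ioo_mem_nhdsGT (by linarith : (0 : ℝ) < 2 - α)] with η hη hη' x hx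
    obtain ⟨hη1, hη2⟩ := hη
    obtain ⟨-, hη3⟩ := hη'
    obtain ⟨hx1, hx2⟩ := abs_lt.1 hx
    have ha : ¬ ∃ j : ℤ, 2 * (k : ℝ) + α = 2 * j := fun ⟨j, hj⟩ =>
      ne_even_of_lt (k := k) (by linarith) (by linarith) j hj
    have e1 : x - η = 2 * k + (x - η - 2 * k) := by ring
    have m1 : x - η - 2 * k ∈ Ioc (0 : ℝ) 2 := ⟨by linarith, by linarith⟩
    have e2 : x = 2 * k + (x - 2 * k) := by ring
    have m3 : x - 2 * k ∈ Ioc (0 : ℝ) 2 := ⟨by linarith, by linarith⟩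
    refine ⟨?_, ⟨fun h => absurd h.1 ha, fun _ => ⟨?_, ?_⟩⟩, fun ⟨j, hj⟩ => ?_⟩
    · rw [e1, spin_int_add k m1, spin_int_add k ⟨h1, h2.le⟩]
    · rw [e1, residue_int_add k m1, e2, residue_int_add k m3]; ring
    · rw [e2, spin_int_add k m3, spin_int_add k ⟨h1, h2.le⟩]
    · exact absurd hj (ne_even_of_lt (k := k) (by linarith) (by linarith) j)

/-! ### Energy, drift and projected velocities -/

variable {N : ℕ} {A : Matrix (Fin N) (Fin N) ℝ}

/-- The piecewise linear energy, which extends the cut from binary to continuous states. -/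
def energy (A : Matrix (Fin N) (Fin N) ℝ) (x : Fin N → ℝ) : ℝ :=
  (1 / 2) * ∑ m, ∑ n, A m n * tent (x m - x n)

/-- The vector field with `oddPhi` instead of `phi`. -/
def drift (A : Matrix (Fin N) (Fin N) ℝ) (x : Fin N → ℝ) : Fin N → ℝ :=
  fun m => ∑ n, A m n * oddPhi (x m - x n)

/-- `w` moves all those components of `x` alike that agree modulo `2`. -/
def Locked (x w : Fin N → ℝ) : Prop :=
  ∀ m n, (∃ k : ℤ, x m - x n = 2 * k) → w m = w n

/-- `v` is the orthogonal projection of the drift to the space of locked vectors. -/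
structure IsVelocity (A : Matrix (Fin N) (Fin N) ℝ) (x v : Fin N → ℝ) : Prop where
  locked : Locked x v
  dot : ∀ w, Locked x w → v ⬝ᵥ w = drift A x ⬝ᵥ w

theorem sum_antisymm_mul (hA : A.IsSymm) (f : Fin N → Fin N → ℝ) (w : Fin N → ℝ)
    (hf : ∀ m n, f n m = -f m n) :
    ∑ m, (∑ n, A m n * f m n) * w m = (1 / 2) * ∑ m, ∑ n, A m n * (f m n * (w m - w n)) := by
  have h1 : ∑ m, ∑ n, A m n * (f m n * w n) = -∑ m, ∑ n, A m n * (f m n * w m) := by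
    rw [Finset.sum_comm, ← Finset.sum_neg_distrib]
    refine Finset.sum_congr rfl fun m _ => ?_
    rw [← Finset.sum_neg_distrib]
    refine Finset.sum_congr rfl fun n _ => ?_
    rw [hA.apply, hf m n]; ring
  have h2 : ∑ m, ∑ n, A m n * (f m n * (w m - w n)) =
      ∑ m, ∑ n, A m n * (f m n * w m) - ∑ m, ∑ n, A m n * (f m n * w n) := by
    simp only [← Finset.sum_sub_distrib, mul_sub]
  rw [h2, h1]
  simp only [Finset.sum_mul, mul_assoc]
  ring

theorem drift_dot (hA : A.IsSymm) (x w : Fin N → ℝ) :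
    drift A x ⬝ᵥ w = (1 / 2) * ∑ m, ∑ n, A m n * (oddPhi (x m - x n) * (w m - w n)) :=
  sum_antisymm_mul hA (fun m n => oddPhi (x m - x n)) w fun m n => by
    rw [← oddPhi_neg, neg_sub]

theorem energy_eq (hA : A.IsSymm) (x : Fin N → ℝ) (r : ℝ) :
    energy A x = cut A (rounding r x) + drift A x ⬝ᵥ (fun m => residue (x m - r)) := by
  rw [drift_dot hA, energy, cut, ← mul_add, ← Finset.sum_add_distrib]
  simp only [← Finset.sum_add_distrib, ← mul_add]
  refine congrArg _ (Finset.sum_congr rfl fun m _ => Finset.sum_congr rfl fun n _ => ?_)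
  rw [← sub_sub_sub_cancel_right (x m) (x n) r, tent_sub_eq]
  rfl

theorem locked_residue (x : Fin N → ℝ) (r : ℝ) : Locked x fun m => residue (x m - r) :=
  fun m n ⟨_, hk⟩ => residue_eq_of_sub (by rw [sub_sub_sub_cancel_right]; exact hk)

theorem IsVelocity.sum_eq_zero (hA : A.IsSymm) {x v : Fin N → ℝ} (h : IsVelocity A x v) :
    ∑ m, v m = 0 := by
  have h1 := h.dot (fun _ => 1) fun _ _ _ => rfl
  rw [drift_dot hA] at h1
  simpa [dotProduct] using h1

/-- Since the residues form a locked vector, the drift may be replaced by its projection. -/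
theorem IsVelocity.energy_eq (hA : A.IsSymm) {x v : Fin N → ℝ} (h : IsVelocity A x v) (r : ℝ) :
    energy A x = cut A (rounding r x) + v ⬝ᵥ (fun m => residue (x m - r)) := by
  rw [GW2.energy_eq hA x r, h.dot _ (locked_residue x r)]

/-! ### Filippov's set tested on locked vectors -/

theorem volume_hyperplane (m n : Fin N) (hmn : m ≠ n) (c : ℝ) :
    volume {x : Fin N → ℝ | x m - x n = c} = 0 := by
  let ℓ : (Fin N → ℝ) →ₗ[ℝ] ℝ := (LinearMap.proj m : (Fin N → ℝ) →ₗ[ℝ] ℝ) - LinearMap.proj n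
  let S : AffineSubspace ℝ (Fin N → ℝ) :=
    (AffineSubspace.mk' c (⊥ : Submodule ℝ ℝ)).comap ℓ.toAffineMap
  have hS : (S : Set (Fin N → ℝ)) = {x | x m - x n = c} := by
    ext x
    simp [S, ℓ, AffineSubspace.mem_mk', sub_eq_zero]
  rw [← hS]
  refine Measure.addHaar_affineSubspace volume S fun h => ?_
  have h1 : ∀ x : Fin N → ℝ, x m - x n = c := fun x => by
    have : x ∈ (S : Set (Fin N → ℝ)) := by rw [h]; trivial
    rwa [hS] at this
  have h2 := h1 0
  have h3 := h1 (Pi.single m 1)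
  simp [hmn.symm] at h2 h3
  linarith

theorem volume_coincidence (N : ℕ) :
    volume {x : Fin N → ℝ | ∃ m n, m ≠ n ∧ ∃ k : ℤ, x m - x n = 2 * k} = 0 := by
  have : {x : Fin N → ℝ | ∃ m n, m ≠ n ∧ ∃ k : ℤ, x m - x n = 2 * k} ⊆
      ⋃ (m : Fin N) (n : Fin N) (_ : m ≠ n) (k : ℤ), {x | x m - x n = 2 * k} := by
    rintro x ⟨m, n, hmn, k, hk⟩
    simp only [mem_iUnion]
    exact ⟨m, n, hmn, k, hk⟩
  refine measure_mono_null this ?_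
  simp only [measure_iUnion_null_iff]
  exact fun m n hmn k => volume_hyperplane m n hmn _

theorem filippov_dot_eq {f : (Fin N → ℝ) → Fin N → ℝ} {x v w : Fin N → ℝ} {c δ : ℝ}
    {Z : Set (Fin N → ℝ)} (hv : v ∈ filippov f x) (hδ : 0 < δ) (hZ : volume Z = 0)
    (h : ∀ y ∈ Metric.ball x δ \ Z, f y ⬝ᵥ w = c) : v ⬝ᵥ w = c := by
  have hcl : IsClosed {u : Fin N → ℝ | u ⬝ᵥ w = c} :=
    isClosed_eq (continuous_id.dotProduct continuous_const) continuous_const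
  have hcv : Convex ℝ {u : Fin N → ℝ | u ⬝ᵥ w = c} := by
    intro a ha b hb s t _ _ hst
    simp only [mem_ofPred_eq] at ha hb ⊢
    rw [add_dotProduct, smul_dotProduct, smul_dotProduct, ha, hb, ← add_smul, hst, one_smul]
  refine closure_minimal (convexHull_min ?_ hcv) hcl (hv δ hδ Z hZ)
  rintro _ ⟨y, hy, rfl⟩
  exact h y hy

/-- By antisymmetry only the differences `w m - w n` enter the product. They vanish for pairs on a
discontinuity, and the other slopes are locally constant. Off a null set near `x` the field thus
lies in one hyperplane, which contains the closed convex hull. -/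
theorem filippov_dot (hA : A.IsSymm) {x v w : Fin N → ℝ} (hv : v ∈ filippov (field A) x)
    (hw : Locked x w) : v ⬝ᵥ w = drift A x ⬝ᵥ w := by
  have hloc : ∀ᶠ y in 𝓝 x, ∀ m n, ¬ (∃ k : ℤ, x m - x n = 2 * k) →
      oddPhi (y m - y n) = oddPhi (x m - x n) := by
    refine eventually_all.2 fun m => eventually_all.2 fun n => ?_
    by_cases h : ∃ k : ℤ, x m - x n = 2 * k
    · exact Eventually.of_forall fun y hy => absurd h hy
    · have hc : Tendsto (fun y : Fin N → ℝ => y m - y n) (𝓝 x) (𝓝 (x m - x n)) :=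
        ((continuous_apply m).sub (continuous_apply n)).tendsto x
      exact (hc.eventually (oddPhi_eventually_eq h)).mono fun y hy _ => hy
  obtain ⟨δ, hδ, hball⟩ := Metric.eventually_nhds_iff_ball.1 hloc
  refine filippov_dot_eq hv hδ (volume_coincidence N) fun y hy => ?_
  have hfield : field A y = drift A y := by
    funext m
    refine Finset.sum_congr rfl fun n _ => ?_
    by_cases hmn : m = n
    · subst hmn
      have h0 : oddPhi 0 = 0 := by simpa using oddPhi_even 0
      have h1 : toIocMod period_pos (-2) (0 : ℝ) = 0 :=
        (toIocMod_eq_iff _).2 ⟨⟨by norm_num, by norm_num⟩, 0, by simp⟩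
      rw [sub_self, h0, phi, h1]; simp
    · rw [oddPhi_eq_phi fun h => hy.2 ⟨m, n, hmn, h⟩]
  rw [hfield, drift_dot hA, drift_dot hA]
  refine congrArg _ (Finset.sum_congr rfl fun m _ => Finset.sum_congr rfl fun n _ => ?_)
  by_cases h : ∃ k : ℤ, x m - x n = 2 * k
  · rw [hw m n h]; simp
  · rw [hball y hy.1 m n h]

/-! ### Finitely many velocities -/

/-- The pattern of values of `oddPhi` determines both the drift and, through its zeros, the locked
space; the projection is then unique. Finiteness of the set of velocities follows by counting
patterns. -/
theorem IsVelocity.unique {x y v w : Fin N → ℝ} (hv : IsVelocity A x v) (hw : IsVelocity A y w)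
    (h : ∀ m n, oddPhi (x m - x n) = oddPhi (y m - y n)) : v = w := by
  have hd : drift A x = drift A y := by
    funext m
    simp only [drift, h]
  have hl : ∀ u, Locked x u ↔ Locked y u := fun u => by
    simp only [Locked, ← oddPhi_eq_zero_iff, h]
  have hs : Locked x (v - w) := fun m n hmn => by
    rw [Pi.sub_apply, Pi.sub_apply, hv.locked m n hmn, (hl w).2 hw.locked m n hmn]
  have h1 : (v - w) ⬝ᵥ (v - w) = 0 := by
    rw [sub_dotProduct, hv.dot _ hs, hw.dot _ ((hl _).1 hs), hd, sub_self]
  exact sub_eq_zero.1 (dotProduct_self_eq_zero.1 h1)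

theorem finite_velocities (A : Matrix (Fin N) (Fin N) ℝ) :
    {v | ∃ x, IsVelocity A x v}.Finite := by
  choose! p hp using fun (v : Fin N → ℝ) (h : ∃ x, IsVelocity A x v) => h
  have hfin : {s : Fin N → Fin N → ℝ | ∀ m n, s m n ∈ ({0, 1 / 2, -1 / 2} : Set ℝ)}.Finite := by
    have := Set.Finite.pi' (fun _ : Fin N => Set.Finite.pi' (fun _ : Fin N =>
      (Set.toFinite ({0, 1 / 2, -1 / 2} : Set ℝ))))
    exact this
  refine Set.Finite.of_injOn (f := fun v m n => oddPhi (p v m - p v n))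
    (t := {s : Fin N → Fin N → ℝ | ∀ m n, s m n ∈ ({0, 1 / 2, -1 / 2} : Set ℝ)}) ?_ ?_ hfin
  · intro v _ m n
    exact oddPhi_mem _
  intro v hv w hw h
  exact (hp v hv).unique (hp w hw) fun m n => congrFun (congrFun h m) n

theorem exists_speed_bound (A : Matrix (Fin N) (Fin N) ℝ) :
    ∃ c > 0, ∀ x v, IsVelocity A x v → v ≠ 0 → c ≤ v ⬝ᵥ v := by
  have hpos : ∀ v : Fin N → ℝ, v ≠ 0 → 0 < v ⬝ᵥ v := fun v hv =>
    lt_of_le_of_ne (Finset.sum_nonneg fun i _ => mul_self_nonneg _)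
      fun h => hv (dotProduct_self_eq_zero.1 h.symm)
  have hfin := ((finite_velocities A).subset (sep_subset _ fun v => v ≠ 0))
  rcases eq_empty_or_nonempty {v ∈ {v | ∃ x, IsVelocity A x v} | v ≠ 0} with he | hne
  · refine ⟨1, one_pos, fun x v hv h0 => ?_⟩
    exact absurd (show v ∈ {v ∈ {v | ∃ x, IsVelocity A x v} | v ≠ 0} from ⟨⟨x, hv⟩, h0⟩)
      (by rw [he]; simp)
  · obtain ⟨u, hu, hmin⟩ := Set.exists_min_image _ (fun v : Fin N → ℝ => v ⬝ᵥ v) hfin hne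
    exact ⟨u ⬝ᵥ u, hpos u hu.2, fun x v hv h0 => hmin v ⟨⟨x, hv⟩, h0⟩⟩

/-! ### The cut near a given state -/

/-- The change of the cut when some components of `x₀` cross the boundary of the rounding. -/
theorem eventually_cut_rounding (hA : A.IsSymm) (x₀ : Fin N → ℝ) :
    ∀ᶠ η in 𝓝[>] (0 : ℝ), ∀ x, (∀ m, |x m - x₀ m| < η) →
      (∀ v, IsVelocity A x v → cut A (rounding 0 x) - cut A (rounding 0 x₀) =
        2 * ∑ m, open Classical in
          if (∃ k : ℤ, x₀ m = 2 * k) ∧ x₀ m < x m then v m else 0) ∧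
      ((∀ m, (∃ k : ℤ, x₀ m = 2 * k) → x m ≤ x₀ m) → rounding 0 x = rounding 0 x₀) ∧
      ∀ m, (∃ k : ℤ, x m = 2 * k) → (∃ k : ℤ, x₀ m = 2 * k) ∧ x m = x₀ m := by
  have := eventually_all.2 fun m => eventually_shift (x₀ m)
  filter_upwards [this] with η hη x hx
  refine ⟨fun v hv => ?_, fun h => ?_, fun m => (hη m (x m) (hx m)).2.2⟩
  · have h0 := hv.energy_eq hA 0
    have h1 := hv.energy_eq hA η
    have hr : rounding η x = rounding 0 x₀ := by
      funext m
      simpa [rounding] using (hη m (x m) (hx m)).1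
    rw [hr] at h1
    have h2 : v ⬝ᵥ (fun m => residue (x m - η)) - v ⬝ᵥ (fun m => residue (x m - 0)) =
        2 * (∑ m, open Classical in
          if (∃ k : ℤ, x₀ m = 2 * k) ∧ x₀ m < x m then v m else 0) - η * ∑ m, v m := by
      simp only [dotProduct, Finset.mul_sum, ← Finset.sum_sub_distrib]
      refine Finset.sum_congr rfl fun m _ => ?_
      obtain ⟨-, ⟨hc, hn⟩, -⟩ := hη m (x m) (hx m)
      split_ifs with h
      · rw [hc h, sub_zero]; ring
      · rw [(hn h).1, sub_zero]; ring
    -- The uniform shift of the residues by `-η` contributes nothing, since the mean of the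
    -- components is conserved.
    rw [hv.sum_eq_zero hA] at h2
    linarith
  · funext m
    have := ((hη m (x m) (hx m)).2.1.2 fun h' => absurd (h m h'.1) (not_le.2 h'.2)).2
    simpa [rounding] using this

/-! ### Absolute continuity and local-to-global tools -/

theorem absolutelyContinuous_comp {X Y : Type*} [PseudoMetricSpace X] [PseudoMetricSpace Y]
    {f : ℝ → X} {g : X → Y} {K a b : ℝ} (hf : AbsolutelyContinuousOnInterval f a b)
    (hg : ∀ x y, dist (g x) (g y) ≤ K * dist x y) :
    AbsolutelyContinuousOnInterval (fun t => g (f t)) a b := by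
  refine squeeze_zero (fun t => ?_) (fun t => ?_) (by simpa using Tendsto.const_mul K hf)
  · exact Finset.sum_nonneg fun i _ => dist_nonneg
  · rw [Finset.mul_sum]
    exact Finset.sum_le_sum fun i _ => hg _ _

theorem absolutelyContinuous_sum {ι : Type*} (s : Finset ι) {f : ι → ℝ → ℝ} {a b : ℝ}
    (hf : ∀ i ∈ s, AbsolutelyContinuousOnInterval (f i) a b) :
    AbsolutelyContinuousOnInterval (fun t => ∑ i ∈ s, f i t) a b := by
  classical
  induction s using Finset.induction_on with
  | empty =>
    simp only [Finset.sum_empty]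
    exact (LipschitzWith.const (0 : ℝ)).lipschitzOnWith.absolutelyContinuousOnInterval
  | insert i s hi ih =>
    simp only [Finset.sum_insert hi]
    exact (hf i (Finset.mem_insert_self i s)).fun_add
      (ih fun j hj => hf j (Finset.mem_insert_of_mem hj))

theorem sub_le_of_ae_deriv_le {f : ℝ → ℝ} {a b C : ℝ} (hab : a ≤ b)
    (hf : AbsolutelyContinuousOnInterval f a b)
    (hd : ∀ᵐ t, t ∈ Ioo a b → ∃ d ≤ C, HasDerivAt f d t) : f b - f a ≤ C * (b - a) := by
  rw [← hf.integral_deriv_eq_sub]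
  have hC : ∫ _ in a..b, C = C * (b - a) := by
    rw [intervalIntegral.integral_const, smul_eq_mul, mul_comm]
  rw [← hC]
  refine intervalIntegral.integral_mono_ae_restrict hab hf.intervalIntegrable_deriv
    intervalIntegrable_const ?_
  rw [Filter.EventuallyLE, ← Measure.restrict_congr_set Ioo_ae_eq_Icc,
    ae_restrict_iff' measurableSet_Ioo]
  filter_upwards [hd] with t ht hmem
  obtain ⟨d, hd, h⟩ := ht hmem
  rwa [h.deriv]

theorem le_sub_of_ae_le_deriv {f : ℝ → ℝ} {a b C : ℝ} (hab : a ≤ b)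
    (hf : AbsolutelyContinuousOnInterval f a b)
    (hd : ∀ᵐ t, t ∈ Ioo a b → ∃ d, C ≤ d ∧ HasDerivAt f d t) : C * (b - a) ≤ f b - f a := by
  have h := sub_le_of_ae_deriv_le (f := fun t => -f t) (C := -C) hab hf.fun_neg (by
    filter_upwards [hd] with t ht hmem
    obtain ⟨d, hd, h⟩ := ht hmem
    exact ⟨-d, neg_le_neg hd, h.fun_neg⟩)
  linarith

theorem ae_differentiableAt_of_pos {f : ℝ → ℝ}
    (hf : ∀ T, 0 < T → AbsolutelyContinuousOnInterval f 0 T) :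
    ∀ᵐ t, 0 < t → DifferentiableAt ℝ f t := by
  have h : ∀ n : ℕ, ∀ᵐ t, t ∈ uIcc 0 ((n : ℝ) + 1) → DifferentiableAt ℝ f t := fun n =>
    (hf _ (by positivity)).ae_differentiableAt
  filter_upwards [ae_all_iff.2 h] with t ht hpos
  obtain ⟨n, hn⟩ := exists_nat_ge t
  exact ht n (by rw [uIcc_of_le (by positivity)]; exact ⟨hpos.le, by linarith⟩)

theorem hasDerivAt_posPart {y : ℝ → ℝ} {w t : ℝ} (hy : HasDerivAt y w t)
    (hd : DifferentiableAt ℝ (fun s => max (y s) 0) t) :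
    HasDerivAt (fun s => max (y s) 0) (if 0 < y t then w else 0) t := by
  split_ifs with h
  · refine hy.congr_of_eventuallyEq ?_
    filter_upwards [hy.continuousAt.eventually (lt_mem_nhds h)] with s hs
    exact max_eq_left hs.le
  · have hmin : IsLocalMin (fun s => max (y s) 0) t :=
      Eventually.of_forall fun s => by simp [max_eq_right (not_lt.1 h)]
    have := hd.hasDerivAt
    rwa [hmin.deriv_eq_zero] at this

/-- A supremum argument: the left condition shows that the supremum of the points reached from `s`
is itself reached, the right condition that it cannot lie below `t`. -/
theorem rel_of_local {R : ℝ → ℝ → Prop} (hrefl : ∀ s, R s s)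
    (htrans : ∀ s t u, R s t → R t u → R s u) {s t : ℝ} (hst : s ≤ t)
    (hright : ∀ u ∈ Icc s t, ∀ᶠ w in 𝓝[>] u, R u w)
    (hleft : ∀ u ∈ Icc s t, ∀ᶠ w in 𝓝[<] u, s ≤ w → R w u) : R s t := by
  let S : Set ℝ := {u | u ∈ Icc s t ∧ R s u}
  have hsS : s ∈ S := ⟨⟨le_rfl, hst⟩, hrefl s⟩
  have hbdd : BddAbove S := ⟨t, fun u hu => hu.1.2⟩
  have hc : sSup S ∈ Icc s t := ⟨le_csSup hbdd hsS, csSup_le ⟨s, hsS⟩ fun u hu => hu.1.2⟩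
  have hRc : R s (sSup S) := by
    obtain ⟨l, hl, hlS⟩ := (mem_nhdsLT_iff_exists_Ioo_subset).1 (hleft _ hc)
    obtain ⟨u, hu, hlu⟩ := exists_lt_of_lt_csSup ⟨s, hsS⟩ hl
    rcases (le_csSup hbdd hu).eq_or_lt with h | h
    · exact h ▸ hu.2
    · exact htrans _ _ _ hu.2 (hlS ⟨hlu, h⟩ hu.1.1)
  rcases hc.2.eq_or_lt with h | h
  · exact h ▸ hRc
  · obtain ⟨u, hu, hlt, hut⟩ := ((hright _ hc).and (Ioo_mem_nhdsGT h)).exists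
    exact absurd (le_csSup hbdd ⟨⟨hc.1.trans hlt.le, hut.le⟩, htrans _ _ _ hRc hu⟩) (not_le.2 hlt)

/-! ### Velocity and energy along trajectories -/

namespace IsTrajectory

variable {ξ : ℝ → Fin N → ℝ}

theorem absCont_comp (h : IsTrajectory A ξ) {g : (Fin N → ℝ) → ℝ} {K : ℝ}
    (hg : ∀ x y, dist (g x) (g y) ≤ K * dist x y) {T : ℝ} (hT : 0 < T) :
    AbsolutelyContinuousOnInterval (fun t => g (ξ t)) 0 T :=
  absolutelyContinuous_comp (h.absCont T hT) hg

theorem continuousOn (h : IsTrajectory A ξ) : ContinuousOn ξ (Ici 0) := by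
  intro t ht
  have ht' : (0 : ℝ) ≤ t := ht
  have h1 := (h.absCont (t + 1) (by linarith)).continuousOn
  rw [uIcc_of_le (by linarith)] at h1
  refine (h1 t ⟨ht', by linarith⟩).mono_of_mem_nhdsWithin ?_
  rw [← Ici_inter_Iic]
  exact inter_mem_nhdsWithin _ (Iic_mem_nhds (by linarith))

theorem dist_tent_le (m n : Fin N) (x y : Fin N → ℝ) :
    dist (tent (x m - x n)) (tent (y m - y n)) ≤ 2 * dist x y := by
  have h1 := abs_tent_sub_le (x m - x n) (y m - y n)
  have h2 := dist_le_pi_dist x y m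
  have h3 := dist_le_pi_dist x y n
  rw [Real.dist_eq] at *
  have h4 : |x m - x n - (y m - y n)| ≤ |x m - y m| + |x n - y n| := by
    rw [sub_sub_sub_comm]; exact abs_sub _ _
  linarith

theorem absCont_energy (h : IsTrajectory A ξ) {T : ℝ} (hT : 0 < T) :
    AbsolutelyContinuousOnInterval (fun t => energy A (ξ t)) 0 T :=
  (absolutelyContinuous_sum _ fun m _ => absolutelyContinuous_sum _ fun n _ =>
    (h.absCont_comp (dist_tent_le m n) hT).const_mul (A m n)).const_mul (1 / 2)

/-- Almost everywhere the curve and all the functions `tent (ξ s m - ξ s n)` are differentiable,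
which forces the velocity to be locked. It may therefore serve as its own test vector in
`filippov_dot`. -/
theorem ae_velocity (hA : A.IsSymm) (h : IsTrajectory A ξ) : ∀ᵐ t, 0 < t →
    ∃ v, v ∈ filippov (field A) (ξ t) ∧ HasDerivAt ξ v t ∧ IsVelocity A (ξ t) v ∧
      HasDerivAt (fun s => energy A (ξ s)) (v ⬝ᵥ v) t := by
  have hd : ∀ m n, ∀ᵐ t, 0 < t → DifferentiableAt ℝ (fun s => tent (ξ s m - ξ s n)) t :=
    fun m n => ae_differentiableAt_of_pos fun T hT => h.absCont_comp (dist_tent_le m n) hT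
  have hv := (ae_restrict_iff' measurableSet_Ioi).1 h.velocity
  filter_upwards [hv, ae_all_iff.2 fun m => ae_all_iff.2 fun n => hd m n] with t ht hd hpos
  obtain ⟨v, hv, hξ⟩ := ht hpos
  have hcomp : ∀ m, HasDerivAt (fun s => ξ s m) (v m) t := hasDerivAt_pi.1 hξ
  have hlock : Locked (ξ t) v := fun m n hmn =>
    sub_eq_zero.1 (deriv_eq_zero_of_tent_comp ((hcomp m).fun_sub (hcomp n)) (hd m n hpos) hmn)
  refine ⟨v, hv, hξ, ⟨hlock, fun w hw => filippov_dot hA hv hw⟩, ?_⟩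
  rw [filippov_dot hA hv hlock, drift_dot hA]
  refine HasDerivAt.const_mul _ (HasDerivAt.fun_sum fun m _ => HasDerivAt.fun_sum fun n _ =>
    HasDerivAt.const_mul _ ?_)
  exact hasDerivAt_tent_comp ((hcomp m).fun_sub (hcomp n)) (hd m n hpos)

end IsTrajectory

/-! ### Monotonicity of the cut -/

/-- The rounding of `y` is that of `x`, or it has a larger cut. -/
def CutLE (A : Matrix (Fin N) (Fin N) ℝ) (x y : Fin N → ℝ) : Prop :=
  rounding 0 x = rounding 0 y ∨ cut A (rounding 0 x) < cut A (rounding 0 y)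

theorem CutLE.le {x y : Fin N → ℝ} (h : CutLE A x y) :
    cut A (rounding 0 x) ≤ cut A (rounding 0 y) := by
  rcases h with h | h
  · rw [h]
  · exact h.le

theorem CutLE.trans {x y z : Fin N → ℝ} (h : CutLE A x y) (h' : CutLE A y z) : CutLE A x z := by
  rcases h with h | h
  · rwa [CutLE, h]
  · exact Or.inr (h.trans_le h'.le)

/-- The total distance by which the even components of `x₀` have increased in `x`. -/
def excess (x₀ x : Fin N → ℝ) : ℝ :=
  ∑ m, open Classical in if ∃ k : ℤ, x₀ m = 2 * k then max (x m - x₀ m) 0 else 0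

open Classical in
/-- The number of even components. -/
def evenCount (x : Fin N → ℝ) : ℕ := (Finset.univ.filter fun m => ∃ k : ℤ, x m = 2 * k).card

theorem excess_term_nonneg (x₀ x : Fin N → ℝ) (m : Fin N) :
    0 ≤ (open Classical in if ∃ k : ℤ, x₀ m = 2 * k then max (x m - x₀ m) 0 else 0) := by
  split_ifs
  · exact le_max_right _ _
  · exact le_rfl

theorem excess_nonneg (x₀ x : Fin N → ℝ) : 0 ≤ excess x₀ x :=
  Finset.sum_nonneg fun m _ => excess_term_nonneg x₀ x m

theorem excess_self (x : Fin N → ℝ) : excess x x = 0 := by simp [excess]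

theorem excess_eq_zero_iff {x₀ x : Fin N → ℝ} :
    excess x₀ x = 0 ↔ ∀ m, (∃ k : ℤ, x₀ m = 2 * k) → x m ≤ x₀ m := by
  rw [excess, Finset.sum_eq_zero_iff_of_nonneg fun m _ => excess_term_nonneg x₀ x m]
  refine forall_congr' fun m => ?_
  by_cases h : ∃ k : ℤ, x₀ m = 2 * k <;> simp [h]

/-- No component becomes newly even near `x₀`, and one that has moved up from an even value is no
longer even. -/
theorem evenCount_lt_of_excess_pos {x₀ x : Fin N → ℝ}
    (h : ∀ m, (∃ k : ℤ, x m = 2 * k) → (∃ k : ℤ, x₀ m = 2 * k) ∧ x m = x₀ m)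
    (hpos : 0 < excess x₀ x) : evenCount x < evenCount x₀ := by
  classical
  have h1 : ¬ ∀ m, (∃ k : ℤ, x₀ m = 2 * k) → x m ≤ x₀ m :=
    fun h' => hpos.ne' (excess_eq_zero_iff.2 h')
  push Not at h1
  obtain ⟨m, hm, hlt⟩ := h1
  refine Finset.card_lt_card ((Finset.ssubset_iff_of_subset fun n hn => ?_).2 ⟨m, ?_, fun hm' => ?_⟩)
  · simp only [Finset.mem_filter, Finset.mem_univ, true_and] at hn ⊢
    exact (h n hn).1
  · simpa using hm
  · simp only [Finset.mem_filter, Finset.mem_univ, true_and] at hm'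
    exact hlt.ne' (h m hm').2

namespace IsTrajectory

variable {ξ : ℝ → Fin N → ℝ}

theorem dist_posPart_le (c : ℝ) (m : Fin N) (x y : Fin N → ℝ) :
    dist (max (x m - c) 0) (max (y m - c) 0) ≤ 1 * dist x y := by
  have h1 := abs_max_sub_max_le_abs (x m - c) (y m - c) 0
  rw [sub_sub_sub_cancel_right] at h1
  rw [one_mul, Real.dist_eq]
  exact h1.trans (dist_le_pi_dist x y m)

theorem absCont_excess (h : IsTrajectory A ξ) (x₀ : Fin N → ℝ) {a b : ℝ} (ha : 0 ≤ a)
    (hab : a ≤ b) : AbsolutelyContinuousOnInterval (fun t => excess x₀ (ξ t)) a b := by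
  have h1 : AbsolutelyContinuousOnInterval (fun t => excess x₀ (ξ t)) 0 (b + 1) := by
    refine absolutelyContinuous_sum _ fun m _ => ?_
    by_cases hm : ∃ k : ℤ, x₀ m = 2 * k
    · simp only [hm, if_true]
      exact h.absCont_comp (dist_posPart_le (x₀ m) m) (by linarith)
    · simp only [hm, if_false]
      exact (LipschitzWith.const (0 : ℝ)).lipschitzOnWith.absolutelyContinuousOnInterval
  refine h1.mono ?_
  rw [uIcc_of_le hab, uIcc_of_le (by linarith)]
  exact Icc_subset_Icc ha (by linarith)

theorem ae_hasDerivAt_excess (hA : A.IsSymm) (h : IsTrajectory A ξ) (x₀ : Fin N → ℝ) :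
    ∀ᵐ t, 0 < t → ∃ v, IsVelocity A (ξ t) v ∧ HasDerivAt (fun s => excess x₀ (ξ s))
      (∑ m, open Classical in if (∃ k : ℤ, x₀ m = 2 * k) ∧ x₀ m < ξ t m then v m else 0) t := by
  have hd : ∀ m, ∀ᵐ t, 0 < t → DifferentiableAt ℝ (fun s => max (ξ s m - x₀ m) 0) t :=
    fun m => ae_differentiableAt_of_pos fun T hT => h.absCont_comp (dist_posPart_le (x₀ m) m) hT
  filter_upwards [h.ae_velocity hA, ae_all_iff.2 hd] with t ht hd hpos
  obtain ⟨v, -, hξ, hv, -⟩ := ht hpos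
  refine ⟨v, hv, HasDerivAt.fun_sum fun m _ => ?_⟩
  by_cases hm : ∃ k : ℤ, x₀ m = 2 * k
  · simp only [hm, if_true, true_and]
    have := hasDerivAt_posPart (((hasDerivAt_pi.1 hξ) m).sub_const (x₀ m)) (hd m hpos)
    simpa only [sub_pos] using this
  · simp only [hm, if_false, false_and]
    exact hasDerivAt_const _ _

/-- Around each time there is a window in which the excess governs the cut. -/
theorem exists_window (hA : A.IsSymm) (h : IsTrajectory A ξ) {t₀ : ℝ} (ht₀ : 0 ≤ t₀) :
    ∃ δ > 0, (∀ t, 0 ≤ t → |t - t₀| < δ →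
      (excess (ξ t₀) (ξ t) = 0 → rounding 0 (ξ t) = rounding 0 (ξ t₀)) ∧
      (0 < excess (ξ t₀) (ξ t) → evenCount (ξ t) < evenCount (ξ t₀))) ∧
      ∀ᵐ t, 0 < t → |t - t₀| < δ → HasDerivAt (fun s => excess (ξ t₀) (ξ s))
        ((cut A (rounding 0 (ξ t)) - cut A (rounding 0 (ξ t₀))) / 2) t := by
  obtain ⟨η, hη, hη0⟩ :=
    ((eventually_cut_rounding hA (ξ t₀)).and self_mem_nhdsWithin).exists
  have hη0 : (0 : ℝ) < η := hη0
  obtain ⟨δ, hδ, hball⟩ := Metric.continuousOn_iff.1 h.continuousOn t₀ ht₀ η hη0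
  have hclose : ∀ t, 0 ≤ t → |t - t₀| < δ → ∀ m, |ξ t m - ξ t₀ m| < η := fun t ht htδ m =>
    (dist_le_pi_dist (ξ t) (ξ t₀) m).trans_lt (hball t ht htδ)
  refine ⟨δ, hδ, fun t ht htδ => ?_, ?_⟩
  · obtain ⟨-, h2, h3⟩ := hη (ξ t) (hclose t ht htδ)
    exact ⟨fun h0 => h2 (excess_eq_zero_iff.1 h0), evenCount_lt_of_excess_pos h3⟩
  · filter_upwards [h.ae_hasDerivAt_excess hA (ξ t₀)] with t ht hpos htδ
    obtain ⟨v, hv, hd⟩ := ht hpos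
    rw [(hη (ξ t) (hclose t hpos.le htδ)).1 v hv, mul_div_cancel_left₀ _ two_ne_zero]
    exact hd

/-- Strong induction on the number of even components at `t₀`. Accumulation of spin flips at `t₀` is
not excluded beforehand; integrating the excess between one of its zeros and `t` avoids the issue.
-/
theorem cutLE_local (hA : A.IsSymm) (h : IsTrajectory A ξ) (n : ℕ) : ∀ t₀, 0 ≤ t₀ →
    evenCount (ξ t₀) = n → (∀ᶠ t in 𝓝[>] t₀, CutLE A (ξ t₀) (ξ t)) ∧
      ∀ᶠ t in 𝓝[<] t₀, 0 ≤ t → CutLE A (ξ t) (ξ t₀) := by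
  induction n using Nat.strong_induction_on with
  | _ n ih =>
  intro t₀ ht₀ hn
  obtain ⟨δ, hδ, hwin, hder⟩ := h.exists_window hA ht₀
  -- On an interval of positive excess the even count is below `n`, so the induction hypothesis
  -- holds at each of its points.
  have hchain : ∀ s t, 0 ≤ s → s ≤ t → (∀ u ∈ Icc s t, |u - t₀| < δ) →
      (∀ u ∈ Icc s t, 0 < excess (ξ t₀) (ξ u)) → CutLE A (ξ s) (ξ t) := by
    intro s t hs hst hu hpos
    have hloc := fun u (hu' : u ∈ Icc s t) =>
      ih _ (hn ▸ (hwin u (hs.trans hu'.1) (hu u hu')).2 (hpos u hu')) u (hs.trans hu'.1) rfl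
    exact rel_of_local (R := fun s t => CutLE A (ξ s) (ξ t)) (fun _ => Or.inl rfl)
      (fun _ _ _ => CutLE.trans) hst (fun u hu => (hloc u hu).1)
      fun u hu => (hloc u hu).2.mono fun w hw hsw => hw (hs.trans hsw)
  have hpos_of_ne : ∀ u, excess (ξ t₀) (ξ u) ≠ 0 → 0 < excess (ξ t₀) (ξ u) := fun u hu =>
    lt_of_le_of_ne (excess_nonneg _ _) hu.symm
  have hzeros : ∀ a b, 0 ≤ a → a ≤ b →
      IsCompact {u ∈ Icc a b | excess (ξ t₀) (ξ u) = 0} := by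
    intro a b ha hab
    have hc := (h.absCont_excess (ξ t₀) ha hab).continuousOn
    rw [uIcc_of_le hab] at hc
    exact isCompact_Icc.of_isClosed_subset
      (hc.preimage_isClosed_of_isClosed isClosed_Icc isClosed_singleton) (fun u hu => hu.1)
  constructor
  · filter_upwards [Ioo_mem_nhdsGT (by linarith : t₀ < t₀ + δ)] with t ht
    have hw : ∀ u ∈ Icc t₀ t, |u - t₀| < δ := fun u hu =>
      abs_lt.2 ⟨by linarith [hu.1], by linarith [hu.2, ht.2]⟩
    by_cases h0 : excess (ξ t₀) (ξ t) = 0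
    · exact Or.inl ((hwin t (ht₀.trans ht.1.le) (hw t ⟨ht.1.le, le_rfl⟩)).1 h0).symm
    -- `a` is the last zero of the excess up to `t`. After `a` the cut never exceeds its value at
    -- `t`, so the positive excess at `t` is at most `t - a` times half the gain of the cut since
    -- `t₀`.
    obtain ⟨a, ⟨⟨ha1, ha2⟩, ha0⟩, hmax⟩ :=
      (hzeros t₀ t ht₀ ht.1.le).exists_isGreatest ⟨t₀, ⟨le_rfl, ht.1.le⟩, excess_self _⟩
    have hne : ∀ u, a < u → u ≤ t → excess (ξ t₀) (ξ u) ≠ 0 := fun u hu hut hu0 =>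
      absurd (hmax ⟨⟨ha1.trans hu.le, hut⟩, hu0⟩) (not_le.2 hu)
    have hle := sub_le_of_ae_deriv_le
      (C := (cut A (rounding 0 (ξ t)) - cut A (rounding 0 (ξ t₀))) / 2) ha2
      (h.absCont_excess (ξ t₀) (ht₀.trans ha1) ha2) (by
        filter_upwards [hder] with u hu hmem
        refine ⟨_, ?_, hu (ht₀.trans_lt (ha1.trans_lt hmem.1))
          (hw u ⟨ha1.trans hmem.1.le, hmem.2.le⟩)⟩
        have := (hchain u t (ht₀.trans (ha1.trans hmem.1.le)) hmem.2.le
          (fun w hw' => hw w ⟨ha1.trans (hmem.1.le.trans hw'.1), hw'.2⟩)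
          fun w hw' => hpos_of_ne w (hne w (hmem.1.trans_le hw'.1) hw'.2)).le
        linarith)
    rw [ha0, sub_zero] at hle
    have hpos := hpos_of_ne t h0
    by_contra hcon
    have hC : (cut A (rounding 0 (ξ t)) - cut A (rounding 0 (ξ t₀))) / 2 ≤ 0 := by
      have := not_lt.1 fun h' => hcon (Or.inr h')
      linarith
    linarith [mul_nonpos_of_nonpos_of_nonneg hC (sub_nonneg.2 ha2)]
  · filter_upwards [Ioo_mem_nhdsLT (by linarith : t₀ - δ < t₀)] with t ht ht0
    have hw : ∀ u ∈ Icc t t₀, |u - t₀| < δ := fun u hu =>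
      abs_lt.2 ⟨by linarith [hu.1, ht.1], by linarith [hu.2]⟩
    by_cases h0 : excess (ξ t₀) (ξ t) = 0
    · exact Or.inl ((hwin t ht0 (hw t ⟨le_rfl, ht.2.le⟩)).1 h0)
    -- Mirror image: `b` is the first zero from `t` on. The excess must fall to zero by `b`, while
    -- the cut on the way is at least its value at `t`; this value is therefore below the one at
    -- `t₀`.
    obtain ⟨b, ⟨⟨hb1, hb2⟩, hb0⟩, hmin⟩ :=
      (hzeros t t₀ ht0 ht.2.le).exists_isLeast ⟨t₀, ⟨ht.2.le, le_rfl⟩, excess_self _⟩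
    have hne : ∀ u, t ≤ u → u < b → excess (ξ t₀) (ξ u) ≠ 0 := fun u htu hu hu0 =>
      absurd (hmin ⟨⟨htu, hu.le.trans hb2⟩, hu0⟩) (not_le.2 hu)
    have hle := le_sub_of_ae_le_deriv
      (C := (cut A (rounding 0 (ξ t)) - cut A (rounding 0 (ξ t₀))) / 2) hb1
      (h.absCont_excess (ξ t₀) ht0 hb1) (by
        filter_upwards [hder] with u hu hmem
        refine ⟨_, ?_, hu (ht0.trans_lt hmem.1) (hw u ⟨hmem.1.le, hmem.2.le.trans hb2⟩)⟩
        have := (hchain t u ht0 hmem.1.le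
          (fun w hw' => hw w ⟨hw'.1, hw'.2.trans (hmem.2.le.trans hb2)⟩)
          fun w hw' => hpos_of_ne w (hne w hw'.1 (hw'.2.trans_lt hmem.2))).le
        linarith)
    rw [hb0, zero_sub] at hle
    have hpos := hpos_of_ne t h0
    by_contra hcon
    have hC : 0 ≤ (cut A (rounding 0 (ξ t)) - cut A (rounding 0 (ξ t₀))) / 2 := by
      have := not_lt.1 fun h' => hcon (Or.inr h')
      linarith
    linarith [mul_nonneg hC (sub_nonneg.2 hb1)]

theorem cutLE (hA : A.IsSymm) (h : IsTrajectory A ξ) {s t : ℝ} (hs : 0 ≤ s) (hst : s ≤ t) :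
    CutLE A (ξ s) (ξ t) := by
  have hloc := fun u (hu : u ∈ Icc s t) => h.cutLE_local hA _ u (hs.trans hu.1) rfl
  exact rel_of_local (R := fun s t => CutLE A (ξ s) (ξ t)) (fun _ => Or.inl rfl)
    (fun _ _ _ => CutLE.trans) hst (fun u hu => (hloc u hu).1)
    fun u hu => (hloc u hu).2.mono fun w hw hsw => hw (hs.trans hsw)

/-! ### Termination in finite time -/

theorem energy_mul_le (hA : A.IsSymm) (h : IsTrajectory A ξ) {c a b : ℝ} (ha : 0 ≤ a)
    (hab : a ≤ b) (hc : ∀ᵐ t, t ∈ Ioo a b → ∀ v, IsVelocity A (ξ t) v → c ≤ v ⬝ᵥ v) :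
    c * (b - a) ≤ energy A (ξ b) - energy A (ξ a) := by
  have hac : AbsolutelyContinuousOnInterval (fun t => energy A (ξ t)) a b := by
    refine (h.absCont_energy (by linarith : 0 < b + 1)).mono ?_
    rw [uIcc_of_le hab, uIcc_of_le (by linarith)]
    exact Icc_subset_Icc ha (by linarith)
  refine le_sub_of_ae_le_deriv hab hac ?_
  filter_upwards [h.ae_velocity hA, hc] with t ht hc hmem
  obtain ⟨v, -, -, hv, hd⟩ := ht (ha.trans_lt hmem.1)
  exact ⟨_, hc hmem v hv, hd⟩

theorem energy_mono (hA : A.IsSymm) (h : IsTrajectory A ξ) {a b : ℝ} (ha : 0 ≤ a)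
    (hab : a ≤ b) : energy A (ξ a) ≤ energy A (ξ b) := by
  have := h.energy_mul_le hA (c := 0) ha hab (Eventually.of_forall fun t _ v _ =>
    Finset.sum_nonneg fun i _ => mul_self_nonneg _)
  linarith

end IsTrajectory

theorem energy_le (A : Matrix (Fin N) (Fin N) ℝ) (x : Fin N → ℝ) :
    energy A x ≤ (1 / 2) * ∑ m, ∑ n, |A m n| := by
  refine mul_le_mul_of_nonneg_left (Finset.sum_le_sum fun m _ => Finset.sum_le_sum fun n _ => ?_)
    (by norm_num)
  calc A m n * tent (x m - x n) ≤ |A m n| * tent (x m - x n) :=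
        mul_le_mul_of_nonneg_right (le_abs_self _) (tent_nonneg _)
    _ ≤ |A m n| * 1 := mul_le_mul_of_nonneg_left (tent_le_one _) (abs_nonneg _)
    _ = |A m n| := mul_one _

theorem finite_cuts (A : Matrix (Fin N) (Fin N) ℝ) :
    (range fun x => cut A (rounding 0 x)).Finite := by
  have h1 : {s : Fin N → ℝ | ∀ m, s m ∈ ({1, -1} : Set ℝ)}.Finite :=
    Set.Finite.pi' fun _ => Set.toFinite _
  refine (h1.image (cut A)).subset ?_
  rintro _ ⟨x, rfl⟩
  exact ⟨rounding 0 x, fun m => spin_eq_one_or _, rfl⟩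

theorem IsVelocity.energy_eq_cut_of_zero (hA : A.IsSymm) {x : Fin N → ℝ} (h : IsVelocity A x 0)
    (r : ℝ) : energy A x = cut A (rounding r x) := by
  rw [h.energy_eq hA r, zero_dotProduct, add_zero]

namespace IsTrajectory

variable {ξ : ℝ → Fin N → ℝ}

theorem energy_eventually_const (hA : A.IsSymm) (h : IsTrajectory A ξ) :
    ∃ T, 0 ≤ T ∧ ∀ t, T ≤ t → energy A (ξ t) = energy A (ξ T) := by
  have hne : ((fun t => energy A (ξ t)) '' Ici 0).Nonempty := ⟨_, 0, self_mem_Ici, rfl⟩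
  have hbdd : BddAbove ((fun t => energy A (ξ t)) '' Ici 0) :=
    ⟨_, by rintro _ ⟨t, -, rfl⟩; exact energy_le A _⟩
  set L := sSup ((fun t => energy A (ξ t)) '' Ici 0) with hL
  have hleL : ∀ t, 0 ≤ t → energy A (ξ t) ≤ L := fun t ht => le_csSup hbdd ⟨t, ht, rfl⟩
  -- The interval from `y` up to, but excluding, the supremum `L` contains no cut value, so at
  -- energies in it the velocity cannot vanish.
  obtain ⟨y, hy, hyL⟩ : ∃ y, (∀ q ∈ range fun x => cut A (rounding 0 x), q < L → q < y) ∧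
      y < L := by
    have h1 : ∀ᶠ y in 𝓝[<] L, ∀ q ∈ range fun x => cut A (rounding 0 x), q < L → q < y := by
      refine (finite_cuts A).eventually_all.2 fun q _ => ?_
      by_cases hq : q < L
      · filter_upwards [Ioo_mem_nhdsLT hq] with y hy _ using hy.1
      · exact Eventually.of_forall fun y hq' => absurd hq' hq
    exact (h1.and self_mem_nhdsWithin).exists
  obtain ⟨_, ⟨T, hT, rfl⟩, hyT⟩ := exists_lt_of_lt_csSup hne hyL
  have hT : 0 ≤ T := hT
  obtain ⟨c, hc, hspeed⟩ := exists_speed_bound A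
  obtain ⟨S, hTS, hS⟩ : ∃ S, T ≤ S ∧ energy A (ξ S) = L := by
    by_contra! hcon
    have hmul : ∀ b, T ≤ b → c * (b - T) ≤ energy A (ξ b) - energy A (ξ T) := fun b hb =>
      h.energy_mul_le hA hT hb (Eventually.of_forall fun t ht v hv => by
        refine hspeed _ v hv ?_
        rintro rfl
        have h1 := hv.energy_eq_cut_of_zero hA 0
        have h2 : energy A (ξ t) < L :=
          lt_of_le_of_ne (hleL t (hT.trans ht.1.le)) (hcon t ht.1.le)
        have h3 := hy _ ⟨ξ t, rfl⟩ (h1.symm.trans_lt h2)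
        have h4 := h.energy_mono hA hT ht.1.le
        linarith)
    have h1 : 0 ≤ (L - energy A (ξ T) + 1) / c :=
      div_nonneg (by linarith [hleL T hT]) hc.le
    have h2 := hmul (T + (L - energy A (ξ T) + 1) / c) (by linarith)
    rw [add_sub_cancel_left, mul_div_cancel₀ _ hc.ne'] at h2
    have h3 := hleL (T + (L - energy A (ξ T) + 1) / c) (by linarith)
    linarith
  refine ⟨S, hT.trans hTS, fun t ht => le_antisymm ?_ (h.energy_mono hA (hT.trans hTS) ht)⟩
  rw [hS]
  exact hleL t (hT.trans (hTS.trans ht))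

theorem exists_terminal (hA : A.IsSymm) (h : IsTrajectory A ξ) :
    ∃ T, 0 ≤ T ∧ (∀ t, T ≤ t → ξ t = ξ T) ∧ IsEquilibrium A (ξ T) ∧ IsVelocity A (ξ T) 0 := by
  obtain ⟨T, hT, hconst⟩ := h.energy_eventually_const hA
  have hrest : ∀ᵐ t, T < t →
      0 ∈ filippov (field A) (ξ t) ∧ IsVelocity A (ξ t) 0 ∧ HasDerivAt ξ 0 t := by
    filter_upwards [h.ae_velocity hA] with t ht hTt
    obtain ⟨v, hF, hξ, hv, hd⟩ := ht (hT.trans_lt hTt)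
    have h1 : HasDerivAt (fun s => energy A (ξ s)) 0 t :=
      (hasDerivAt_const t (energy A (ξ T))).congr_of_eventuallyEq (by
        filter_upwards [lt_mem_nhds hTt] with s hs using hconst s hs.le)
    obtain rfl : v = 0 := dotProduct_self_eq_zero.1 (hd.unique h1)
    exact ⟨hF, hv, hξ⟩
  have hξT : ∀ t, T ≤ t → ξ t = ξ T := by
    intro t ht
    have hac : AbsolutelyContinuousOnInterval ξ T t := by
      refine (h.absCont (t + 1) (by linarith)).mono ?_
      rw [uIcc_of_le ht, uIcc_of_le (by linarith)]
      exact Icc_subset_Icc hT (by linarith)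
    obtain ⟨C, hC⟩ := hac.const_of_ae_hasDerivAt_zero (by
      filter_upwards [hrest, Measure.ae_ne volume T] with s hs hne hmem
      rw [uIcc_of_le ht] at hmem
      exact (hs (lt_of_le_of_ne hmem.1 hne.symm)).2.2)
    rw [hC t right_mem_uIcc, hC T left_mem_uIcc]
  -- The properties at rest hold only for almost every time after `T`; a single such time suffices,
  -- since the state there is already `ξ T`.
  have : (ae (volume.restrict (Ioi T))).NeBot := by
    rw [ae_neBot, Ne, Measure.restrict_eq_zero, Real.volume_Ioi]
    exact ENNReal.top_ne_zero
  obtain ⟨t, ⟨hF, hv, -⟩, hTt⟩ := (((ae_restrict_iff' measurableSet_Ioi).2 hrest).and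
    (ae_restrict_mem measurableSet_Ioi)).exists
  rw [hξT t (le_of_lt hTt)] at hF hv
  exact ⟨T, hT, hξT, hF, hv⟩

end IsTrajectory

theorem rounding_initial {σ X : Fin N → ℝ} (hσ : IsBinary σ) (hX : ∀ m, X m ∈ Ioc (-1 : ℝ) 1) :
    rounding 0 (σ + X) = σ := by
  funext m
  rw [rounding, sub_zero, spin_eq_iff _ _ (hσ m)]
  exact ⟨X m, hX m, 0, by simp⟩

end GW2

end

theorem theorem4 {N : ℕ} (A : Matrix (Fin N) (Fin N) ℝ) (hA : A.IsSymm)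
    (σ X : Fin N → ℝ) (hσ : GW2.IsBinary σ) (hX : ∀ m, X m ∈ Set.Ioc (-1 : ℝ) 1)
    (ξ : ℝ → Fin N → ℝ) (hξ : GW2.IsTrajectory A ξ) (h0 : ξ 0 = σ + X) :
    (∃ z : Fin N → ℝ, GW2.IsTerminalState ξ z ∧ GW2.IsEquilibrium A z ∧
      ∀ r : ℝ, GW2.cut A σ ≤ GW2.cut A (GW2.rounding r z)) ∧
    (∀ s t : ℝ, 0 ≤ s → s ≤ t →
      GW2.rounding 0 (ξ s) ≠ GW2.rounding 0 (ξ t) →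
      GW2.cut A (GW2.rounding 0 (ξ s)) < GW2.cut A (GW2.rounding 0 (ξ t))) := by
  refine ⟨?_, fun s t hs hst hne => (hξ.cutLE hA hs hst).resolve_left hne⟩
  obtain ⟨T, hT, hconst, heq, hv⟩ := hξ.exists_terminal hA
  refine ⟨ξ T, ⟨T, hT, hconst⟩, heq, fun r => ?_⟩
  have h1 := (hξ.cutLE hA le_rfl hT).le
  rw [h0, GW2.rounding_initial hσ hX] at h1
  rwa [← hv.energy_eq_cut_of_zero hA r, hv.energy_eq_cut_of_zero hA 0]
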